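/- Let $k,n,d\in\mathbb{N}$ with $n\ge k\ge 2$, let $X=\{x_1,\dots,x_n\}\subset\mathbb{R}^d$ be a set of $n$ distinct points with weights $\omega_1,\dots,\omega_n>0$, and let $\kappa^-,\kappa^+\in\mathbb{R}^k$ satisfy $0<\kappa_i^-\le\kappa_i^+$ for all $i\le k$ and $\sum_{i}\kappa_i^-\le\sum_{j}\omega_j\le\sum_i\kappa_i^+$. Let $V$ be a real inner-product space of finite dimension $d_\varphi$, let $\varphi:\mathbb{R}^d\to V$ be a map, and let $s_1,\dots,s_k\in\mathbb{R}^d$ be (not necessarily distinct) initial sites. Let $\mathcal{P}$ be the polytope of all $y=(y_{ij})\in\mathbb{R}^{k\times n}$ with $y_{ij}\ge 0$, $\sum_{i=1}^k y_{ij}=1$ for all $j\le n$, and $\kappa_i^-\le\sum_{j=1}^n y_{ij}\omega_j\le\kappa_i^+$ for all $i\le k$. Weight-balanced kernel $k$-means starts with the sites $s_i^{(1)}:=\varphi(s_i)\in V$ $(i\le k)$, and its $l$-th iteration $(l=1,2,\dots)$ consists of two steps. 1. Compute a basic optimal solution (a vertex of $\mathcal{P}$) $y^{(l)}$ of the linear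 program $$\Theta^{(l)}:=\min_{y\in\mathcal{P}}\ \sum_{i=1}^k\sum_{j=1}^n \omega_j\,y_{ij}\left(\langle s_i^{(l)},s_i^{(l)}\rangle-2\langle\varphi(x_j),s_i^{(l)}\rangle\right);$$ if there are several, any of them may be chosen. 2. Update the sites to the centers of gravity $$s_i^{(l+1)}:=\frac{1}{\sum_{j=1}^n y^{(l)}_{ij}\omega_j}\sum_{j=1}^n y^{(l)}_{ij}\,\omega_j\,\varphi(x_j)\qquad(i\le k).$$ If $l=1$ or $\Theta^{(l)}<\Theta^{(l-1)}$, continue with iteration $l+1$; otherwise return the current assignment and sites. Then every iteration can be carried out, and every execution of the algorithm terminates after at most $$(40\,e\,k^2\,n)^{(d_\varphi+1)k-1}$$ iterations, where $e$ is Euler's number. -/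

import Mathlib

namespace WeightBalancedKernelKMeans

noncomputable section

/-- The size `|C_i| = ∑_j y_ij ω_j` of the `i`-th cluster of the assignment `y`. -/
def clusterSize {k n : ℕ} (ω : Fin n → ℝ) (y : Fin k → Fin n → ℝ) (i : Fin k) : ℝ :=
  ∑ j, y i j * ω j

/-- The weight-balanced partition polytope: the assignment vectors of the clusterings
with `κ⁻ ≤ |C| ≤ κ⁺`. -/
def partitionPolytope {k n : ℕ} (ω : Fin n → ℝ) (κlo κhi : Fin k → ℝ) :
    Set (Fin k → Fin n → ℝ) :=
  {y | (∀ i, κlo i ≤ clusterSize ω y i ∧ clusterSize ω y i ≤ κhi i) ∧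
    (∀ j, ∑ i, y i j = 1) ∧ ∀ i j, 0 ≤ y i j}

variable {V : Type*} [NormedAddCommGroup V] [InnerProductSpace ℝ V]

/-- The objective function `∑_i ∑_j ω_j y_ij (⟨s_i, s_i⟩ - 2 ⟨p_j, s_i⟩)` for points `p_j`
and sites `s_i` in the feature space. -/
def objective {k n : ℕ} (ω : Fin n → ℝ) (p : Fin n → V) (s : Fin k → V)
    (y : Fin k → Fin n → ℝ) : ℝ :=
  ∑ i, ∑ j, ω j * y i j * (inner ℝ (s i) (s i) - 2 * inner ℝ (p j) (s i))

/-- The center of gravity of the `i`-th cluster in the feature space. -/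
def center {k n : ℕ} (ω : Fin n → ℝ) (p : Fin n → V) (y : Fin k → Fin n → ℝ)
    (i : Fin k) : V :=
  (clusterSize ω y i)⁻¹ • ∑ j, (y i j * ω j) • p j

/-- `y` is a possible output of the weight-balanced kernel least-squares assignment for the
sites `s`: an optimal basic feasible solution (that is, an optimal vertex) of the linear program
that minimizes the objective function over the partition polytope. -/
structure IsAssignment {k n : ℕ} (ω : Fin n → ℝ) (κlo κhi : Fin k → ℝ) (p : Fin n → V)
    (s : Fin k → V) (y : Fin k → Fin n → ℝ) : Prop where
  vertex : y ∈ Set.extremePoints ℝ (partitionPolytope ω κlo κhi)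
  optimal : ∀ y' ∈ partitionPolytope ω κlo κhi, objective ω p s y ≤ objective ω p s y'

/-- `S` and `y` record the first `T` iterations of an execution of weight-balanced kernel
`k`-means with feature map `φ`, data points `x` and initial sites `s`. The iterations are numbered
from `0`; iteration `l` computes the assignment `y l` for the sites `S l`, and then replaces the
sites by the centers of gravity `S (l + 1)`. Entries beyond these iterations are irrelevant.
The algorithm goes on after iteration `l + 1` only if the objective value decreased compared with
iteration `l`; after iteration `0` there is no earlier value, and it always goes on. -/
structure IsExecution {k n d : ℕ} (ω : Fin n → ℝ) (κlo κhi : Fin k → ℝ)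
    (φ : EuclideanSpace ℝ (Fin d) → V) (x : Fin n → EuclideanSpace ℝ (Fin d))
    (s : Fin k → EuclideanSpace ℝ (Fin d))
    (T : ℕ) (S : ℕ → Fin k → V) (y : ℕ → Fin k → Fin n → ℝ) : Prop where
  init : ∀ i, S 0 i = φ (s i)
  assign : ∀ l < T, IsAssignment ω κlo κhi (fun j => φ (x j)) (S l) (y l)
  update : ∀ l < T, ∀ i, S (l + 1) i = center ω (fun j => φ (x j)) (y l) i
  goOn : ∀ l, l + 2 < T →
    objective ω (fun j => φ (x j)) (S (l + 1)) (y (l + 1)) <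
      objective ω (fun j => φ (x j)) (S l) (y l)

/-- The execution returns its result after `T` iterations: the last of them did not decrease the
objective value. -/
def HasReturned {k n : ℕ} (ω : Fin n → ℝ) (p : Fin n → V)
    (T : ℕ) (S : ℕ → Fin k → V) (y : ℕ → Fin k → Fin n → ℝ) : Prop :=
  ∃ l, T = l + 2 ∧ ¬ objective ω p (S (l + 1)) (y (l + 1)) < objective ω p (S l) (y l)

end

end WeightBalancedKernelKMeans

/-!
By linear programming duality, `y` is an optimal assignment for the sites `s` iff it satisfies
complementary slackness with multipliers `β` of the size constraints. That condition sees `s` and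
`β` only through the signs of the `β i` and of the differences of the reduced costs
`‖s i‖² - 2 ⟪p j, s i⟫ - β i` of each point `p j` in two clusters. The differences are linear in
the functionals `⟪·, s i⟫` on the span of the points and the constants `‖s i‖² - β i`, of which
one may be normalized to `0`. Hence their sign vectors are the cells of a central arrangement of
`k²n` hyperplanes in a space of dimension `N = (d_φ + 1) k - 1`, and there are at most
`(2k²n + 1) ^ N` of them. Since the objective decreases and centers of gravity are optimal sites
for their assignment, an assignment is no longer optimal two or more iterations later, so that the
even iterations have distinct sign data.
-/

namespace WeightBalancedKernelKMeans

open Module Submodule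

section Farkas

variable {𝕜 W ι : Type*} [Field 𝕜] [LinearOrder 𝕜] [IsStrictOrderedRing 𝕜] [AddCommGroup W]
  [Module 𝕜 W]

theorem exists_nonneg_eq_mul_of_eq_zero_on_ker {U : Submodule 𝕜 W} {a d : Dual 𝕜 W}
    (hd : ∀ x ∈ U ⊓ a.ker, d x = 0) {u : W} (hu : u ∈ U) (hau : a u < 0) (hdu : d u ≤ 0) :
    ∃ t, 0 ≤ t ∧ ∀ x ∈ U, d x = t * a x := by
  refine ⟨d u / a u, div_nonneg_of_nonpos hdu hau.le, fun x hx => ?_⟩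
  have hker : a (x - (a x / a u) • u) = 0 := by
    rw [map_sub, map_smul, smul_eq_mul, div_mul_cancel₀ _ hau.ne, sub_self]
  have hdx := hd _ ⟨U.sub_mem hx (U.smul_mem _ hu), hker⟩
  rw [map_sub, map_smul, smul_eq_mul, sub_eq_zero] at hdx
  rw [hdx, div_mul_comm]

/-- Farkas' lemma. -/
theorem exists_nonneg_eq_sum_mul (s : Finset ι) (a : ι → Dual 𝕜 W) (c : Dual 𝕜 W)
    (U : Submodule 𝕜 W) (h : ∀ x ∈ U, (∀ i ∈ s, 0 ≤ a i x) → 0 ≤ c x) :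
    ∃ r : ι → 𝕜, (∀ i, 0 ≤ r i) ∧ ∀ x ∈ U, c x = ∑ i ∈ s, r i * a i x := by
  classical
  induction s using Finset.induction_on generalizing U with
  | empty =>
    refine ⟨0, fun _ => le_rfl, fun x hx => ?_⟩
    have hneg := h (-x) (U.neg_mem hx) (by simp)
    rw [map_neg, neg_nonneg] at hneg
    simpa using le_antisymm hneg (h x hx (by simp))
  | insert i₀ s hi₀ ih =>
    suffices ∃ (t : 𝕜) (r : ι → 𝕜), 0 ≤ t ∧ (∀ i, 0 ≤ r i) ∧
        ∀ x ∈ U, c x = t * a i₀ x + ∑ i ∈ s, r i * a i x by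
      obtain ⟨t, r, ht, hr, hc⟩ := this
      refine ⟨Function.update r i₀ t, fun i => ?_, fun x hx => ?_⟩
      · rcases eq_or_ne i i₀ with rfl | hi <;> simp [*]
      · rw [Finset.sum_insert hi₀, Function.update_self, hc x hx]
        congr 1
        refine Finset.sum_congr rfl fun i hi => ?_
        rw [Function.update_of_ne (ne_of_mem_of_not_mem hi hi₀)]
    by_cases hc : ∀ x ∈ U, (∀ i ∈ s, 0 ≤ a i x) → 0 ≤ c x
    · obtain ⟨r, hr, hcr⟩ := ih U hc
      exact ⟨0, r, le_rfl, hr, by simpa using hcr⟩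
    · push Not at hc
      obtain ⟨u, hu, hau, hcu⟩ := hc
      have hu₀ : a i₀ u < 0 := lt_of_not_ge fun h₀ =>
        hcu.not_ge (h u hu ((Finset.forall_mem_insert ..).2 ⟨h₀, hau⟩))
      obtain ⟨r, hr, hcr⟩ := ih (U ⊓ (a i₀).ker) fun x hx hax =>
        h x hx.1 ((Finset.forall_mem_insert ..).2 ⟨(LinearMap.mem_ker.1 hx.2).ge, hax⟩)
      have hdiff : ∀ x, (c - ∑ i ∈ s, r i • a i) x = c x - ∑ i ∈ s, r i * a i x := by simp
      have hsum : 0 ≤ ∑ i ∈ s, r i * a i u :=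
        Finset.sum_nonneg fun i hi => mul_nonneg (hr i) (hau i hi)
      obtain ⟨t, ht, hmul⟩ := exists_nonneg_eq_mul_of_eq_zero_on_ker
        (fun x hx => (hdiff x).trans (sub_eq_zero.2 (hcr x hx))) hu hu₀
        ((hdiff u).trans_le (by linarith))
      exact ⟨t, r, ht, hr, fun x hx => by rw [← hmul x hx, hdiff, sub_add_cancel]⟩

theorem exists_multipliers [Fintype ι] (a : ι → Dual 𝕜 W) (c : Dual 𝕜 W) (U : Submodule 𝕜 W)
    {γ : ι → 𝕜} (hγ : ∀ i, 0 ≤ γ i) (h : ∀ x ∈ U, (∀ i, 0 ≤ γ i + a i x) → 0 ≤ c x) :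
    ∃ r : ι → 𝕜, (∀ i, 0 ≤ r i) ∧ (∀ i, r i * γ i = 0) ∧ ∀ x ∈ U, c x = ∑ i, r i * a i x := by
  let A : Option ι → Dual 𝕜 (W × 𝕜) := fun o =>
    o.elim (.snd 𝕜 W 𝕜) fun i => (a i).coprod (γ i • .id)
  have hA : ∀ z ∈ U.prod ⊤, (∀ o ∈ Finset.univ, 0 ≤ A o z) → 0 ≤ (c ∘ₗ .fst 𝕜 W 𝕜) z := by
    rintro ⟨x, t⟩ ⟨hx, -⟩ hz
    have ht : 0 ≤ t := hz none (Finset.mem_univ _)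
    have hax : ∀ i, 0 ≤ a i x + γ i * t := fun i => by simpa [A] using hz (some i)
    change 0 ≤ c x
    rcases ht.eq_or_lt with rfl | ht
    · exact h x hx fun i => add_nonneg (hγ i) (by simpa using hax i)
    · have hscaled : 0 ≤ c (t⁻¹ • x) := h _ (U.smul_mem _ hx) fun i => by
        have := mul_nonneg (inv_nonneg.2 ht.le) (hax i)
        rwa [mul_add, mul_left_comm, inv_mul_cancel₀ ht.ne', mul_one, add_comm, ← smul_eq_mul,
          ← map_smul] at this
      rw [map_smul, smul_eq_mul] at hscaled
      exact nonneg_of_mul_nonneg_right hscaled (inv_pos.2 ht)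
  obtain ⟨r, hr, hcr⟩ := exists_nonneg_eq_sum_mul Finset.univ A _ _ hA
  have hcr' : ∀ x ∈ U, ∀ t, c x = r none * t + ∑ i, r (some i) * (a i x + γ i * t) :=
    fun x hx t => by simpa [A, Fintype.sum_option] using hcr (x, t) ⟨hx, trivial⟩
  have hslack : ∑ i, r (some i) * γ i = 0 := by
    have hsum : 0 = r none + ∑ i, r (some i) * γ i := by simpa using hcr' 0 U.zero_mem 1
    exact le_antisymm (by linarith [hr none])
      (Finset.sum_nonneg fun i _ => mul_nonneg (hr _) (hγ i))
  refine ⟨fun i => r (some i), fun i => hr _, fun i => ?_, fun x hx => by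
    simpa using hcr' x hx 0⟩
  exact (Finset.sum_eq_zero_iff_of_nonneg fun i _ => mul_nonneg (hr _) (hγ i)).1 hslack i
    (Finset.mem_univ i)

end Farkas

section SignVectors

variable {𝕜 W ι : Type*} [Field 𝕜] [LinearOrder 𝕜] [AddCommGroup W] [Module 𝕜 W]

/-- The sign vectors of the arrangement of the hyperplanes `f i = 0` that occur on `X`; they name
the cells, of all dimensions, that meet `X`. -/
def signVectors (f : ι → Dual 𝕜 W) (X : Set W) : Set (ι → SignType) :=
  (fun w i => SignType.sign (f i w)) '' X

theorem signVectors_subset_cons {m : ℕ} (f : Fin (m + 1) → Dual 𝕜 W) (X : Set W) :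
    signVectors f X ⊆
      Fin.cons (-1) '' signVectors (Fin.tail f) (X ∩ {w | f 0 w < 0}) ∪
      Fin.cons 0 '' signVectors (Fin.tail f) (X ∩ {w | f 0 w = 0}) ∪
      Fin.cons 1 '' signVectors (Fin.tail f) (X ∩ {w | 0 < f 0 w}) := by
  rintro _ ⟨w, hw, rfl⟩
  have hcons : ∀ t, SignType.sign (f 0 w) = t →
      Fin.cons t (fun i => SignType.sign (Fin.tail f i w)) = fun i => SignType.sign (f i w) := by
    rintro _ rfl
    exact Fin.cons_self_tail fun i => SignType.sign (f i w)
  rcases lt_trichotomy (f 0 w) 0 with h | h | h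
  · exact .inl (.inl ⟨_, ⟨w, ⟨hw, h⟩, rfl⟩, hcons _ (sign_neg h)⟩)
  · exact .inl (.inr ⟨_, ⟨w, ⟨hw, h⟩, rfl⟩, hcons _ (by rw [h, sign_zero])⟩)
  · exact .inr ⟨_, ⟨w, ⟨hw, h⟩, rfl⟩, hcons _ (sign_pos h)⟩

theorem ncard_signVectors_le_tail {m : ℕ} (f : Fin (m + 1) → Dual 𝕜 W) {X : Set W}
    (h : ∀ w ∈ X, f 0 w = 0) :
    (signVectors f X).ncard ≤ (signVectors (Fin.tail f) X).ncard := by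
  refine (Set.ncard_le_ncard ?_).trans (Set.ncard_image_le (f := Fin.cons 0))
  rintro _ ⟨w, hw, rfl⟩
  refine ⟨_, ⟨w, hw, rfl⟩, funext (Fin.cases ?_ fun i => rfl)⟩
  exact (sign_eq_zero_iff.2 (h w hw)).symm

variable [IsStrictOrderedRing 𝕜]

theorem sign_mul_add_mul {a b x y : 𝕜} (ha : 0 < a) (hb : 0 < b)
    (h : SignType.sign y = SignType.sign x) :
    SignType.sign (a * x + b * y) = SignType.sign x := by
  rcases lt_trichotomy x 0 with hx | rfl | hx
  · rw [sign_neg hx, sign_eq_neg_one_iff] at h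
    rw [sign_neg hx, sign_neg (add_neg (mul_neg_of_pos_of_neg ha hx) (mul_neg_of_pos_of_neg hb h))]
  · rw [sign_zero, sign_eq_zero_iff] at h
    simp [h]
  · rw [sign_pos hx, sign_eq_one_iff] at h
    rw [sign_pos hx, sign_pos (add_pos (mul_pos ha hx) (mul_pos hb h))]

theorem signVectors_neg_inter_pos_subset (f : ι → Dual 𝕜 W) (g : Dual 𝕜 W) (U : Submodule 𝕜 W) :
    signVectors f (U ∩ {w | g w < 0}) ∩ signVectors f (U ∩ {w | 0 < g w}) ⊆
      signVectors f ↑(U ⊓ g.ker) := by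
  rintro _ ⟨⟨u, ⟨hu, hgu⟩, rfl⟩, v, ⟨hv, hgv⟩, huv⟩
  refine ⟨g v • u + -g u • v, ⟨U.add_mem (U.smul_mem _ hu) (U.smul_mem _ hv), ?_⟩, ?_⟩
  · simp [mul_comm]
  · funext i
    simpa using sign_mul_add_mul hgv (neg_pos.2 hgu) (congrFun huv i)

theorem ncard_signVectors_succ_le {m : ℕ} (f : Fin (m + 1) → Dual 𝕜 W) (U : Submodule 𝕜 W) :
    (signVectors f U).ncard ≤ (signVectors (Fin.tail f) U).ncard +
      2 * (signVectors (Fin.tail f) ↑(U ⊓ (f 0).ker)).ncard := by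
  set N := signVectors (Fin.tail f) (U ∩ {w | f 0 w < 0})
  set Z := signVectors (Fin.tail f) ↑(U ⊓ (f 0).ker)
  set P := signVectors (Fin.tail f) (U ∩ {w | 0 < f 0 w})
  have hunion : (N ∪ P).ncard ≤ (signVectors (Fin.tail f) U).ncard :=
    Set.ncard_le_ncard (Set.union_subset (Set.image_mono Set.inter_subset_left)
      (Set.image_mono Set.inter_subset_left))
  have hinter : (N ∩ P).ncard ≤ Z.ncard :=
    Set.ncard_le_ncard (signVectors_neg_inter_pos_subset (Fin.tail f) (f 0) U)
  calc (signVectors f U).ncard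
      ≤ (Fin.cons (-1) '' N ∪ Fin.cons 0 '' Z ∪ Fin.cons 1 '' P).ncard :=
        Set.ncard_le_ncard (signVectors_subset_cons f U)
    _ ≤ N.ncard + Z.ncard + P.ncard :=
        (Set.ncard_union_le _ _).trans (add_le_add ((Set.ncard_union_le _ _).trans
          (add_le_add Set.ncard_image_le Set.ncard_image_le)) Set.ncard_image_le)
    _ = (N ∪ P).ncard + (N ∩ P).ncard + Z.ncard := by
        rw [Set.ncard_union_add_ncard_inter]
        ring
    _ ≤ _ := by omega

theorem ncard_signVectors_fin_le [FiniteDimensional 𝕜 W] {m : ℕ} (f : Fin m → Dual 𝕜 W)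
    (U : Submodule 𝕜 W) : (signVectors f U).ncard ≤ (2 * m + 1) ^ finrank 𝕜 U := by
  induction m generalizing U with
  | zero => simpa using Set.ncard_le_one_of_subsingleton (signVectors f U)
  | succ m ih =>
    by_cases hU : U ≤ (f 0).ker
    · calc (signVectors f U).ncard
          ≤ (signVectors (Fin.tail f) U).ncard := ncard_signVectors_le_tail f hU
        _ ≤ (2 * m + 1) ^ finrank 𝕜 U := ih _ U
        _ ≤ (2 * (m + 1) + 1) ^ finrank 𝕜 U := by gcongr; omega
    · have hlt : finrank 𝕜 ↥(U ⊓ (f 0).ker) < finrank 𝕜 U :=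
        finrank_lt_finrank_of_lt (inf_lt_left.2 hU)
      obtain ⟨N, hN⟩ := Nat.exists_eq_add_one_of_ne_zero hlt.ne_bot
      calc (signVectors f U).ncard
          ≤ (signVectors (Fin.tail f) U).ncard +
              2 * (signVectors (Fin.tail f) ↑(U ⊓ (f 0).ker)).ncard :=
            ncard_signVectors_succ_le f U
        _ ≤ (2 * m + 1) ^ (N + 1) + 2 * (2 * m + 1) ^ N := by
            gcongr
            · exact hN ▸ ih _ U
            · exact (ih _ _).trans (Nat.pow_le_pow_right (by omega) (by omega))
        _ = (2 * m + 1) ^ N * (2 * (m + 1) + 1) := by ring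
        _ ≤ (2 * (m + 1) + 1) ^ N * (2 * (m + 1) + 1) := by gcongr; omega
        _ = (2 * (m + 1) + 1) ^ finrank 𝕜 U := by rw [hN, pow_succ]

theorem ncard_signVectors_le [FiniteDimensional 𝕜 W] [Fintype ι] (f : ι → Dual 𝕜 W)
    (U : Submodule 𝕜 W) :
    (signVectors f U).ncard ≤ (2 * Fintype.card ι + 1) ^ finrank 𝕜 U := by
  let e := Fintype.equivFin ι
  refine le_trans (Set.ncard_le_ncard_of_injOn (fun σ => σ ∘ e.symm) ?_
    e.symm.surjective.injective_comp_right.injOn) (ncard_signVectors_fin_le (f ∘ e.symm) U)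
  rintro _ ⟨w, hw, rfl⟩
  exact ⟨w, hw, rfl⟩

end SignVectors


section Duality

variable {k n : ℕ} {ω : Fin n → ℝ} {κlo κhi : Fin k → ℝ} {g : Fin k → Fin n → ℝ}
  {y : Fin k → Fin n → ℝ}

/-- The cluster size as a linear functional of the assignment. -/
def clusterSizeDual (ω : Fin n → ℝ) (i : Fin k) : Dual ℝ (Fin k → Fin n → ℝ) where
  toFun y := clusterSize ω y i
  map_add' y z := by simp [clusterSize, add_mul, Finset.sum_add_distrib]
  map_smul' c y := by simp [clusterSize, Finset.mul_sum, mul_assoc]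

@[simp] theorem clusterSizeDual_apply (ω : Fin n → ℝ) (i : Fin k) (y : Fin k → Fin n → ℝ) :
    clusterSizeDual ω i y = clusterSize ω y i := rfl

/-- The cost of an assignment as a linear functional, if `g i j` is the price of putting a unit of
weight of the `j`-th point into the `i`-th cluster. For the prices `siteCost` it is `objective`. -/
def transportCost (ω : Fin n → ℝ) (g : Fin k → Fin n → ℝ) : Dual ℝ (Fin k → Fin n → ℝ) where
  toFun y := ∑ i, ∑ j, ω j * y i j * g i j
  map_add' y z := by simp [mul_add, add_mul, Finset.sum_add_distrib]
  map_smul' c y := by simp [Finset.mul_sum, mul_left_comm, mul_assoc]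

/-- Complementary slackness of the assignment `y` and the multipliers `β` of the size constraints,
for the unit prices `g`; `β i` is the multiplier of the lower bound on the `i`-th size minus that of
the upper bound. The multipliers of `∑ i, y i j = 1` are eliminated: `g i j - β i` is minimal over
`i` wherever `y i j` is positive. -/
structure IsComplementary (ω : Fin n → ℝ) (κlo κhi : Fin k → ℝ) (g : Fin k → Fin n → ℝ)
    (β : Fin k → ℝ) (y : Fin k → Fin n → ℝ) : Prop where
  support : ∀ i j, 0 < y i j → ∀ i', g i j - β i ≤ g i' j - β i'
  lower : ∀ i, 0 < β i → clusterSize ω y i = κlo i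
  upper : ∀ i, β i < 0 → clusterSize ω y i = κhi i

theorem transportCost_eq_sum_reduced_add (β : Fin k → ℝ) (y : Fin k → Fin n → ℝ) :
    transportCost ω g y =
      ∑ j, ω j * ∑ i, y i j * (g i j - β i) + ∑ i, β i * clusterSize ω y i := by
  change ∑ i, ∑ j, ω j * y i j * g i j = _
  simp only [clusterSize, Finset.mul_sum]
  rw [Finset.sum_comm (γ := Fin n), ← Finset.sum_add_distrib]
  refine Finset.sum_congr rfl fun i _ => ?_
  rw [← Finset.sum_add_distrib]
  exact Finset.sum_congr rfl fun j _ => by ring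

theorem add_mem_partitionPolytope (hy : y ∈ partitionPolytope ω κlo κhi)
    {z : Fin k → Fin n → ℝ} (hz : ∑ i, z i = 0) (hentry : ∀ i j, 0 ≤ y i j + z i j)
    (hlo : ∀ i, 0 ≤ clusterSize ω y i - κlo i + clusterSize ω z i)
    (hhi : ∀ i, 0 ≤ κhi i - clusterSize ω y i - clusterSize ω z i) :
    y + z ∈ partitionPolytope ω κlo κhi := by
  refine ⟨fun i => ?_, fun j => ?_, hentry⟩
  · rw [show clusterSize ω (y + z) i = _ from map_add (clusterSizeDual ω i) y z]
    change _ ≤ clusterSize ω y i + clusterSize ω z i ∧ clusterSize ω y i + clusterSize ω z i ≤ _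
    constructor <;> linarith [hlo i, hhi i]
  · have hzj : ∑ i, z i j = 0 := by simpa using congrFun hz j
    simp [Finset.sum_add_distrib, hy.2.1 j, hzj]

theorem exists_polytope_multipliers (hy : y ∈ partitionPolytope ω κlo κhi)
    (hmin : IsMinOn (transportCost ω g) (partitionPolytope ω κlo κhi) y) :
    ∃ (ρ : Fin k → Fin n → ℝ) (lo hi : Fin k → ℝ),
      (∀ i j, 0 ≤ ρ i j ∧ ρ i j * y i j = 0) ∧
      (∀ i, 0 ≤ lo i ∧ lo i * (clusterSize ω y i - κlo i) = 0) ∧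
      (∀ i, 0 ≤ hi i ∧ hi i * (κhi i - clusterSize ω y i) = 0) ∧
      ∀ z, ∑ i, z i = 0 → transportCost ω g z =
        ∑ i, ∑ j, ρ i j * z i j + ∑ i, (lo i - hi i) * clusterSize ω z i := by
  let a : (Fin k × Fin n) ⊕ (Fin k ⊕ Fin k) → Dual ℝ (Fin k → Fin n → ℝ) :=
    Sum.elim (fun q => .proj q.2 ∘ₗ .proj q.1)
      (Sum.elim (clusterSizeDual ω) fun i => -clusterSizeDual ω i)
  let γ : (Fin k × Fin n) ⊕ (Fin k ⊕ Fin k) → ℝ :=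
    Sum.elim (fun q => y q.1 q.2)
      (Sum.elim (fun i => clusterSize ω y i - κlo i) fun i => κhi i - clusterSize ω y i)
  let U : Submodule ℝ (Fin k → Fin n → ℝ) := LinearMap.ker (∑ i, .proj i)
  have hU : ∀ z, z ∈ U ↔ ∑ i, z i = 0 := fun z => by simp [U]
  have hγ : ∀ q, 0 ≤ γ q := by
    rintro (q | i | i)
    exacts [hy.2.2 _ _, sub_nonneg.2 (hy.1 i).1, sub_nonneg.2 (hy.1 i).2]
  obtain ⟨r, hr, hrγ, hc⟩ := exists_multipliers a (transportCost ω g) U hγ fun z hz hz' => by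
    have hmem := add_mem_partitionPolytope hy ((hU z).1 hz) (fun i j => hz' (.inl (i, j)))
      (fun i => hz' (.inr (.inl i))) fun i => hz' (.inr (.inr i))
    have hle := isMinOn_iff.1 hmin _ hmem
    rwa [map_add, le_add_iff_nonneg_right] at hle
  refine ⟨fun i j => r (.inl (i, j)), fun i => r (.inr (.inl i)), fun i => r (.inr (.inr i)),
    fun i j => ⟨hr _, hrγ (.inl (i, j))⟩, fun i => ⟨hr _, hrγ (.inr (.inl i))⟩,
    fun i => ⟨hr _, hrγ (.inr (.inr i))⟩, fun z hz => ?_⟩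
  rw [hc z ((hU z).2 hz)]
  simp [a, Fintype.sum_prod_type, sub_mul, ← sub_eq_add_neg]

theorem eq_of_forall_sum_mul_eq_zero {ι κ R : Type*} [Fintype ι] [Fintype κ] [Ring R]
    {F : ι → κ → R} (hF : ∀ z : ι → κ → R, ∑ i, z i = 0 → ∑ i, ∑ j, F i j * z i j = 0)
    (i i' : ι) (j : κ) : F i j = F i' j := by
  classical
  have h := hF (Pi.single i (Pi.single j 1) - Pi.single i' (Pi.single j 1)) (by simp)
  have hsum : ∀ l, ∑ i, ∑ j', F i j' * (Pi.single l (Pi.single j 1) : ι → κ → R) i j' = F l j := by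
    intro l
    rw [Finset.sum_eq_single l (fun i _ hi => by simp [hi]) (by simp)]
    simp [Pi.single_apply]
  simpa [mul_sub, hsum, sub_eq_zero] using h

theorem exists_isComplementary (hω : ∀ j, 0 < ω j) (hy : y ∈ partitionPolytope ω κlo κhi)
    (hmin : IsMinOn (transportCost ω g) (partitionPolytope ω κlo κhi) y) :
    ∃ β, IsComplementary ω κlo κhi g β y := by
  obtain ⟨ρ, lo, hi, hρ, hlo, hhi, hcost⟩ := exists_polytope_multipliers hy hmin
  have hreduced : ∀ i i' j, ω j * (g i j - (lo i - hi i)) - ρ i j =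
      ω j * (g i' j - (lo i' - hi i')) - ρ i' j := by
    refine eq_of_forall_sum_mul_eq_zero (F := fun i j => ω j * (g i j - (lo i - hi i)) - ρ i j)
      fun z hz => ?_
    rw [← sub_eq_zero.2 (hcost z hz)]
    simp only [transportCost, LinearMap.coe_mk, AddHom.coe_mk, clusterSize, Finset.mul_sum,
      ← Finset.sum_add_distrib, ← Finset.sum_sub_distrib]
    exact Finset.sum_congr rfl fun i _ => Finset.sum_congr rfl fun j _ => by ring
  refine ⟨fun i => lo i - hi i, fun i j hij i' => ?_, fun i hi' => ?_, fun i hi' => ?_⟩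
  · have hρij : ρ i j = 0 := (mul_eq_zero_iff_right hij.ne').1 (hρ i j).2
    refine le_of_mul_le_mul_left ?_ (hω j)
    linarith [hreduced i i' j, (hρ i' j).1]
  · have hpos : 0 < lo i := by linarith [(hhi i).1]
    exact sub_eq_zero.1 ((mul_eq_zero_iff_left hpos.ne').1 (hlo i).2)
  · have hpos : 0 < hi i := by linarith [(hlo i).1]
    exact (sub_eq_zero.1 ((mul_eq_zero_iff_left hpos.ne').1 (hhi i).2)).symm

theorem sum_mul_le_sum_mul_of_support_le {ι R : Type*} [Fintype ι] [CommRing R] [LinearOrder R]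
    [IsStrictOrderedRing R] {w w' r : ι → R} (hw : ∀ i, 0 ≤ w i) (hw' : ∀ i, 0 ≤ w' i)
    (hsum : ∑ i, w i = 1) (hsum' : ∑ i, w' i = 1) (h : ∀ i, 0 < w i → ∀ i', r i ≤ r i') :
    ∑ i, w i * r i ≤ ∑ i, w' i * r i := by
  have hle : ∀ i', ∑ i, w i * r i ≤ r i' := fun i' => by
    rw [← one_mul (r i'), ← hsum, Finset.sum_mul]
    refine Finset.sum_le_sum fun i _ => ?_
    rcases (hw i).eq_or_lt with hi | hi
    · rw [← hi, zero_mul, zero_mul]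
    · exact mul_le_mul_of_nonneg_left (h i hi i') hi.le
  rw [← one_mul (∑ i, w i * r i), ← hsum', Finset.sum_mul]
  exact Finset.sum_le_sum fun i' _ => mul_le_mul_of_nonneg_left (hle i') (hw' i')

theorem IsComplementary.isMinOn {β : Fin k → ℝ} (h : IsComplementary ω κlo κhi g β y)
    (hω : ∀ j, 0 ≤ ω j) (hy : y ∈ partitionPolytope ω κlo κhi) :
    IsMinOn (transportCost ω g) (partitionPolytope ω κlo κhi) y := by
  refine isMinOn_iff.2 fun z hz => ?_
  rw [transportCost_eq_sum_reduced_add β, transportCost_eq_sum_reduced_add β]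
  refine add_le_add (Finset.sum_le_sum fun j _ => mul_le_mul_of_nonneg_left ?_ (hω j))
    (Finset.sum_le_sum fun i _ => ?_)
  · exact sum_mul_le_sum_mul_of_support_le (hy.2.2 · j) (hz.2.2 · j) (hy.2.1 j) (hz.2.1 j)
      fun i hi => h.support i j hi
  · rcases lt_trichotomy (β i) 0 with hβ | hβ | hβ
    · rw [h.upper i hβ]
      exact mul_le_mul_of_nonpos_left (hz.1 i).2 hβ.le
    · rw [hβ, zero_mul, zero_mul]
    · rw [h.lower i hβ]
      exact mul_le_mul_of_nonneg_left (hz.1 i).1 hβ.le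

end Duality

section Vertices

variable {k n : ℕ} {ω : Fin n → ℝ} {κlo κhi : Fin k → ℝ}

theorem partitionPolytope_nonempty (hκlo : ∀ i, 0 ≤ κlo i) (hκ : ∀ i, κlo i ≤ κhi i)
    (hω : 0 < ∑ j, ω j) (hlo : ∑ i, κlo i ≤ ∑ j, ω j) (hhi : ∑ j, ω j ≤ ∑ i, κhi i) :
    (partitionPolytope ω κlo κhi).Nonempty := by
  obtain ⟨size, ⟨hlo_size, hsize_hi⟩, hsize⟩ : ∃ size ∈ Set.Icc κlo κhi, ∑ i, size i = ∑ j, ω j :=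
    (convex_Icc κlo κhi).isPreconnected.intermediate_value (Set.left_mem_Icc.2 hκ)
      (Set.right_mem_Icc.2 hκ) (by fun_prop) ⟨hlo, hhi⟩
  refine ⟨fun i _ => size i / ∑ j, ω j, fun i => ?_, fun _ => ?_, fun i _ => ?_⟩
  · rw [clusterSize, ← Finset.mul_sum, div_mul_cancel₀ _ hω.ne']
    exact ⟨hlo_size i, hsize_hi i⟩
  · rw [← Finset.sum_div, hsize, div_self hω.ne']
  · exact div_nonneg ((hκlo i).trans (hlo_size i)) hω.le

theorem isCompact_partitionPolytope : IsCompact (partitionPolytope ω κlo κhi) := by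
  refine (isCompact_Icc (a := (0 : Fin k → Fin n → ℝ)) (b := 1)).of_isClosed_subset ?_ ?_
  · simp only [partitionPolytope, clusterSize, Set.ofPred_and, Set.ofPred_forall]
    refine IsClosed.inter ?_ (IsClosed.inter ?_ ?_)
    · exact isClosed_iInter fun i => (isClosed_le (by fun_prop) (by fun_prop)).inter
        (isClosed_le (by fun_prop) (by fun_prop))
    · exact isClosed_iInter fun _ => isClosed_eq (by fun_prop) (by fun_prop)
    · exact isClosed_iInter fun _ => isClosed_iInter fun _ =>
        isClosed_le (by fun_prop) (by fun_prop)
  · intro y hy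
    refine ⟨hy.2.2, fun i j => ?_⟩
    exact (Finset.single_le_sum (fun i _ => hy.2.2 i j) (Finset.mem_univ i)).trans_eq (hy.2.1 j)

theorem exists_mem_extremePoints_isMinOn {E : Type*} [AddCommGroup E] [Module ℝ E]
    [TopologicalSpace E] [T2Space E] [IsTopologicalAddGroup E] [ContinuousSMul ℝ E]
    [LocallyConvexSpace ℝ E] {A : Set E} (hA : IsCompact A) (hne : A.Nonempty)
    (c : StrongDual ℝ E) : ∃ x ∈ A.extremePoints ℝ, IsMinOn c A x := by
  have hface : IsExposed ℝ A ((-c).toExposed A) := ContinuousLinearMap.toExposed.isExposed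
  obtain ⟨z, hz, hmin⟩ := hA.exists_isMinOn hne c.continuous.continuousOn
  obtain ⟨x, hx⟩ := (hface.isCompact hA).extremePoints_nonempty
    ⟨z, hz, fun y hy => neg_le_neg (hmin hy)⟩
  exact ⟨x, hface.isExtreme.extremePoints_subset_extremePoints hx,
    fun y hy => neg_le_neg_iff.1 (hx.1.2 y hy)⟩

end Vertices

section Arrangement

variable {𝕜 ι κ E W : Type*} [Field 𝕜] [AddCommGroup E] [Module 𝕜 E] [AddCommGroup W] [Module 𝕜 W]

variable (𝕜 ι) in
/-- The difference of the prices of putting the point `p q.2.2` into the clusters `q.1` and `q.2.1`,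
as a linear functional of the prices: `w` stands for the prices `(w i).1 (p j) + (w i).2`, affine
in the point. -/
def costDifference (p : κ → E) (q : ι × ι × κ) : Dual 𝕜 (ι → Dual 𝕜 E × 𝕜) :=
  (Dual.eval 𝕜 E (p q.2.2)).coprod .id ∘ₗ .proj q.1 -
    (Dual.eval 𝕜 E (p q.2.2)).coprod .id ∘ₗ .proj q.2.1

variable (𝕜 W) in
/-- The affine price parameters whose constant term vanishes at the cluster `i₀`. A common shift of
the prices of all clusters does not affect `costDifference`, so they lose no sign vector. -/
def normalizedParameters (i₀ : ι) : Submodule 𝕜 (ι → W × 𝕜) :=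
  LinearMap.ker (.snd 𝕜 W 𝕜 ∘ₗ .proj i₀)

theorem finrank_normalizedParameters [FiniteDimensional 𝕜 W] [Fintype ι] (i₀ : ι) :
    finrank 𝕜 (normalizedParameters 𝕜 W i₀) = (finrank 𝕜 W + 1) * Fintype.card ι - 1 := by
  have hne : (.snd 𝕜 W 𝕜 ∘ₗ .proj i₀ : Dual 𝕜 (ι → W × 𝕜)) ≠ 0 := fun h =>
    one_ne_zero (α := 𝕜) (LinearMap.congr_fun h fun _ => (0, 1))
  have h := Module.Dual.finrank_ker_add_one_of_ne_zero hne
  rw [finrank_pi_fintype] at h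
  simp only [finrank_prod, finrank_self, Finset.sum_const, Finset.card_univ, smul_eq_mul] at h
  rw [mul_comm, ← h]
  rfl

theorem ncard_signVectors_costDifference_le [LinearOrder 𝕜] [IsStrictOrderedRing 𝕜]
    [FiniteDimensional 𝕜 E] [Fintype ι] [Fintype κ] (p : κ → E) (i₀ : ι) :
    (signVectors (costDifference 𝕜 ι p) (normalizedParameters 𝕜 (Dual 𝕜 E) i₀)).ncard ≤
      (2 * (Fintype.card ι * (Fintype.card ι * Fintype.card κ)) + 1) ^
        ((finrank 𝕜 E + 1) * Fintype.card ι - 1) := by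
  simpa only [finrank_normalizedParameters, Subspace.dual_finrank_eq, Fintype.card_prod] using
    ncard_signVectors_le (costDifference 𝕜 ι p) (normalizedParameters 𝕜 (Dual 𝕜 E) i₀)

end Arrangement

section SignData

variable {k n : ℕ} {ω : Fin n → ℝ} {κlo κhi : Fin k → ℝ}

/-- The signs of the differences of the reduced prices `g i j - β i` of each point. -/
noncomputable def reducedCostSigns (g : Fin k → Fin n → ℝ) (β : Fin k → ℝ)
    (q : Fin k × Fin k × Fin n) : SignType :=
  SignType.sign ((g q.1 q.2.2 - β q.1) - (g q.2.1 q.2.2 - β q.2.1))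

theorem IsComplementary.congr {g g' : Fin k → Fin n → ℝ} {β β' : Fin k → ℝ}
    {y : Fin k → Fin n → ℝ} (h : IsComplementary ω κlo κhi g β y)
    (hcost : reducedCostSigns g β = reducedCostSigns g' β')
    (hβ : ∀ i, SignType.sign (β i) = SignType.sign (β' i)) :
    IsComplementary ω κlo κhi g' β' y := by
  refine ⟨fun i j hij i' => ?_, fun i hi => h.lower i ?_, fun i hi => h.upper i ?_⟩
  · by_contra! hlt
    have hsign : reducedCostSigns g' β' (i, i', j) = 1 := sign_eq_one_iff.2 (sub_pos.2 hlt)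
    rw [← hcost] at hsign
    exact (h.support i j hij i').not_gt (sub_pos.1 (sign_eq_one_iff.1 hsign))
  · exact sign_eq_one_iff.1 ((hβ i).trans (sign_pos hi))
  · exact sign_eq_neg_one_iff.1 ((hβ i).trans (sign_neg hi))

variable {V : Type*} [NormedAddCommGroup V] [InnerProductSpace ℝ V]

/-- The unit prices in the objective function for the points `p` and the sites `s`. -/
noncomputable def siteCost (p : Fin n → V) (s : Fin k → V) (i : Fin k) (j : Fin n) : ℝ :=
  inner ℝ (s i) (s i) - 2 * inner ℝ (p j) (s i)

theorem reducedCostSigns_siteCost_mem (i₀ : Fin k) {E : Submodule ℝ V} (p : Fin n → E)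
    (s : Fin k → V) (β : Fin k → ℝ) :
    reducedCostSigns (siteCost (fun j => (p j : V)) s) β ∈
      signVectors (costDifference ℝ (Fin k) p) (normalizedParameters ℝ (Dual ℝ E) i₀) := by
  refine ⟨fun i => (-(2 : ℝ) • (innerₛₗ ℝ (s i)).domRestrict E,
    inner ℝ (s i) (s i) - β i - (inner ℝ (s i₀) (s i₀) - β i₀)), sub_self _, funext fun q => ?_⟩
  change SignType.sign (_ : ℝ) = SignType.sign (_ : ℝ)
  congr 1
  simp [costDifference, siteCost, real_inner_comm]
  ring

/-- The indices have distinct sign data: if those of `l < l'` agreed, then the multipliers of `l'`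
would certify that `y l` is optimal for `s l'`. -/
theorem le_of_forall_lt_not_isMinOn (i₀ : Fin k) (hω : ∀ j, 0 < ω j) (p : Fin n → V) {m : ℕ}
    (s : Fin m → Fin k → V) (y : Fin m → Fin k → Fin n → ℝ)
    (hy : ∀ l, y l ∈ partitionPolytope ω κlo κhi)
    (hmin : ∀ l, IsMinOn (objective ω p (s l)) (partitionPolytope ω κlo κhi) (y l))
    (hnot : ∀ l l', l < l' →
      ¬ IsMinOn (objective ω p (s l')) (partitionPolytope ω κlo κhi) (y l)) :
    m ≤ (2 * (k * (k * n)) + 1) ^ ((finrank ℝ (span ℝ (Set.range p)) + 1) * k - 1) * 3 ^ k := by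
  let E := span ℝ (Set.range p)
  let p' : Fin n → E := fun j => ⟨p j, subset_span ⟨j, rfl⟩⟩
  have : FiniteDimensional ℝ E := .span_of_finite ℝ (Set.finite_range p)
  let P := signVectors (costDifference ℝ (Fin k) p') (normalizedParameters ℝ (Dual ℝ E) i₀)
  choose β hβ using fun l =>
    exists_isComplementary (g := siteCost p (s l)) hω (hy l) (hmin l)
  let signData : Fin m → P × (Fin k → SignType) := fun l =>
    (⟨_, reducedCostSigns_siteCost_mem i₀ p' (s l) (β l)⟩, fun i => SignType.sign (β l i))
  have hinj : Function.Injective signData := Function.Injective.of_lt_imp_ne fun l l' hlt heq =>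
    hnot l l' hlt (((hβ l).congr (congrArg Subtype.val (congrArg Prod.fst heq))
      (congrFun (congrArg Prod.snd heq))).isMinOn (fun j => (hω j).le) (hy l))
  have hP : P.ncard ≤ (2 * (k * (k * n)) + 1) ^ ((finrank ℝ E + 1) * k - 1) := by
    simpa only [Fintype.card_fin] using ncard_signVectors_costDifference_le p' i₀
  calc m = Nat.card (Fin m) := (Nat.card_fin m).symm
    _ ≤ Nat.card (P × (Fin k → SignType)) := Nat.card_le_card_of_injective signData hinj
    _ = P.ncard * 3 ^ k := by
      simp [Nat.card_prod, Nat.card_coe_set_eq, show Fintype.card SignType = 3 from rfl]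
    _ ≤ _ := Nat.mul_le_mul_right _ hP

end SignData

section Algorithm

variable {k n : ℕ} {ω : Fin n → ℝ} {κlo κhi : Fin k → ℝ} {V : Type*} [NormedAddCommGroup V]
  [InnerProductSpace ℝ V]

theorem exists_isAssignment (hne : (partitionPolytope ω κlo κhi).Nonempty) (p : Fin n → V)
    (s : Fin k → V) : ∃ y, IsAssignment ω κlo κhi p s y := by
  obtain ⟨y, hy, hmin⟩ := exists_mem_extremePoints_isMinOn isCompact_partitionPolytope hne
    (LinearMap.toContinuousLinearMap (transportCost ω (siteCost p s)))
  exact ⟨y, hy, fun z hz => hmin hz⟩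

theorem sum_siteCost_eq_clusterSize_mul (p : Fin n → V) (s : Fin k → V) {y : Fin k → Fin n → ℝ}
    {i : Fin k} (hi : clusterSize ω y i ≠ 0) :
    ∑ j, ω j * y i j * siteCost p s i j =
      clusterSize ω y i * (inner ℝ (s i) (s i) - 2 * inner ℝ (center ω p y i) (s i)) := by
  have hcenter : clusterSize ω y i * inner ℝ (center ω p y i) (s i) =
      ∑ j, y i j * ω j * inner ℝ (p j) (s i) := by
    rw [center, real_inner_smul_left, mul_inv_cancel_left₀ hi, sum_inner]
    exact Finset.sum_congr rfl fun j _ => real_inner_smul_left _ _ _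
  rw [mul_sub, mul_left_comm, hcenter, clusterSize, Finset.sum_mul, Finset.mul_sum,
    ← Finset.sum_sub_distrib]
  exact Finset.sum_congr rfl fun j _ => by rw [siteCost]; ring

theorem objective_center_le (p : Fin n → V) (s : Fin k → V) {y : Fin k → Fin n → ℝ}
    (hy : ∀ i, 0 < clusterSize ω y i) :
    objective ω p (center ω p y) y ≤ objective ω p s y := by
  refine Finset.sum_le_sum fun i _ => ?_
  change ∑ j, ω j * y i j * siteCost p _ i j ≤ ∑ j, ω j * y i j * siteCost p s i j
  rw [sum_siteCost_eq_clusterSize_mul _ _ (hy i).ne',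
    sum_siteCost_eq_clusterSize_mul _ _ (hy i).ne']
  refine mul_le_mul_of_nonneg_left ?_ (hy i).le
  have hdist := real_inner_self_nonneg (x := s i - center ω p y i)
  rw [real_inner_sub_sub_self] at hdist
  linarith [real_inner_comm (s i) (center ω p y i)]

variable {d : ℕ} {φ : EuclideanSpace ℝ (Fin d) → V} {x : Fin n → EuclideanSpace ℝ (Fin d)}
  {s : Fin k → EuclideanSpace ℝ (Fin d)} {T : ℕ} {S : ℕ → Fin k → V} {y : ℕ → Fin k → Fin n → ℝ}

theorem IsExecution.mem (h : IsExecution ω κlo κhi φ x s T S y) {l : ℕ} (hl : l < T) :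
    y l ∈ partitionPolytope ω κlo κhi :=
  (h.assign l hl).vertex.1

theorem IsExecution.objective_lt (h : IsExecution ω κlo κhi φ x s T S y) {l m : ℕ} (hlm : l < m)
    (hm : m + 1 < T) :
    objective ω (fun j => φ (x j)) (S m) (y m) < objective ω (fun j => φ (x j)) (S l) (y l) := by
  induction m, hlm using Nat.le_induction with
  | base => exact h.goOn l hm
  | succ m _ ih => exact (h.goOn m hm).trans (ih (by omega))

theorem IsExecution.not_isMinOn (h : IsExecution ω κlo κhi φ x s T S y) (hκlo : ∀ i, 0 < κlo i)
    {l m : ℕ} (hlm : l + 1 < m) (hm : m + 1 < T) :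
    ¬ IsMinOn (objective ω (fun j => φ (x j)) (S m)) (partitionPolytope ω κlo κhi) (y l) := by
  intro hmin
  have hl := h.mem (l := l) (by omega)
  have hS : S (l + 1) = center ω (fun j => φ (x j)) (y l) := funext (h.update l (by omega))
  refine (h.objective_lt hlm hm).not_ge ?_
  calc objective ω (fun j => φ (x j)) (S (l + 1)) (y (l + 1))
      ≤ objective ω (fun j => φ (x j)) (S (l + 1)) (y l) :=
        (h.assign (l + 1) (by omega)).optimal _ hl
    _ ≤ objective ω (fun j => φ (x j)) (S m) (y l) :=
        hS ▸ objective_center_le _ _ fun i => (hκlo i).trans_le (hl.1 i).1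
    _ ≤ objective ω (fun j => φ (x j)) (S m) (y m) := hmin (h.mem (by omega))

/-- Only every other iteration is counted, as `y l` may still be optimal in iteration `l + 1`. -/
theorem IsExecution.half_le (h : IsExecution ω κlo κhi φ x s T S y) (hk : 0 < k)
    (hω : ∀ j, 0 < ω j) (hκlo : ∀ i, 0 < κlo i) :
    T / 2 ≤ (2 * (k * (k * n)) + 1) ^
      ((finrank ℝ (span ℝ (Set.range fun j => φ (x j))) + 1) * k - 1) * 3 ^ k :=
  le_of_forall_lt_not_isMinOn ⟨0, hk⟩ hω (fun j => φ (x j)) (fun l : Fin (T / 2) => S (2 * l))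
    (fun l => y (2 * l)) (fun l => h.mem (by omega))
    (fun l => isMinOn_iff.2 (h.assign (2 * l) (by omega)).optimal)
    fun l l' hlt => h.not_isMinOn hκlo (by omega) (by omega)

theorem IsExecution.exists_succ (h : IsExecution ω κlo κhi φ x s T S y)
    (hne : (partitionPolytope ω κlo κhi).Nonempty)
    (hret : ¬ HasReturned ω (fun j => φ (x j)) T S y) :
    ∃ (S' : ℕ → Fin k → V) (y' : ℕ → Fin k → Fin n → ℝ),
      IsExecution ω κlo κhi φ x s (T + 1) S' y' ∧ ∀ l < T, S' l = S l ∧ y' l = y l := by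
  obtain ⟨z, hz⟩ := exists_isAssignment hne (fun j => φ (x j)) (S T)
  let S' := Function.update S (T + 1) (center ω (fun j => φ (x j)) z)
  let y' := Function.update y T z
  have hS : ∀ l ≤ T, S' l = S l := fun l hl => Function.update_of_ne (by omega) _ _
  have hy : ∀ l < T, y' l = y l := fun l hl => Function.update_of_ne hl.ne _ _
  have hyT : y' T = z := Function.update_self _ _ _
  have hST : S' (T + 1) = center ω (fun j => φ (x j)) z := Function.update_self _ _ _
  refine ⟨S', y', ⟨fun i => ?_, fun l hl => ?_, fun l hl i => ?_, fun l hl => ?_⟩,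
    fun l hl => ⟨hS l hl.le, hy l hl⟩⟩
  · rw [hS 0 T.zero_le]
    exact h.init i
  · rcases (Nat.lt_succ_iff.1 hl).eq_or_lt with rfl | hl
    · rwa [hS l le_rfl, hyT]
    · rw [hS l hl.le, hy l hl]
      exact h.assign l hl
  · rcases (Nat.lt_succ_iff.1 hl).eq_or_lt with rfl | hl
    · rw [hST, hyT]
    · rw [hS (l + 1) hl, hy l hl]
      exact h.update l hl i
  · rw [hS l (by omega), hS (l + 1) (by omega), hy l (by omega), hy (l + 1) (by omega)]
    by_contra hlt
    rcases (show l + 2 ≤ T by omega).eq_or_lt with hT | hT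
    · exact hret ⟨l, hT.symm, hlt⟩
    · exact hlt (h.goOn l hT)

end Algorithm

section Arithmetic

theorem le_pow_of_half_le {b c N T : ℕ} (hb : 1 ≤ b) (hc : c + 1 ≤ 3 * N)
    (h : T / 2 ≤ (2 * b + 1) ^ N * 3 ^ c) : T ≤ (81 * b) ^ N := by
  have hpos : 0 < (2 * b + 1) ^ N * 3 ^ c := by positivity
  calc T ≤ 3 * ((2 * b + 1) ^ N * 3 ^ c) := by omega
    _ = (2 * b + 1) ^ N * 3 ^ (c + 1) := by ring
    _ ≤ (3 * b) ^ N * 3 ^ (3 * N) := by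
        gcongr
        · omega
        · norm_num
    _ = (81 * b) ^ N := by
        rw [pow_mul, ← mul_pow]
        congr 1
        ring

theorem cast_eighty_one_mul_le (k n : ℕ) :
    ((81 * (k * (k * n)) : ℕ) : ℝ) ≤ 40 * Real.exp 1 * (k : ℝ) ^ 2 * (n : ℝ) := by
  have he : (81 : ℝ) ≤ 40 * Real.exp 1 := by linarith [Real.exp_one_gt_d9]
  calc ((81 * (k * (k * n)) : ℕ) : ℝ) = 81 * ((k : ℝ) ^ 2 * n) := by push_cast; ring
    _ ≤ 40 * Real.exp 1 * ((k : ℝ) ^ 2 * n) := by gcongr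
    _ = _ := by ring

theorem one_le_forty_mul_exp_one_mul {k n : ℕ} (hk : 0 < k) (hn : 0 < n) :
    1 ≤ 40 * Real.exp 1 * (k : ℝ) ^ 2 * (n : ℝ) :=
  (Nat.one_le_cast.2 (Nat.one_le_iff_ne_zero.2 (by positivity))).trans
    (cast_eighty_one_mul_le k n)

end Arithmetic

end WeightBalancedKernelKMeans

open WeightBalancedKernelKMeans in
theorem corollary6p1_general {V : Type*} [NormedAddCommGroup V] [InnerProductSpace ℝ V]
    (k n d : ℕ) (hk : 2 ≤ k) (x : Fin n → EuclideanSpace ℝ (Fin d))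
    (ω : Fin n → ℝ) (hω : ∀ j, 0 < ω j)
    (κlo κhi : Fin k → ℝ) (hκlo : ∀ i, 0 < κlo i) (hκ : ∀ i, κlo i ≤ κhi i)
    (hlo : ∑ i, κlo i ≤ ∑ j, ω j) (hhi : ∑ j, ω j ≤ ∑ i, κhi i)
    (φ : EuclideanSpace ℝ (Fin d) → V) (s : Fin k → EuclideanSpace ℝ (Fin d))
    (T : ℕ) (S : ℕ → Fin k → V) (y : ℕ → Fin k → Fin n → ℝ)
    (hrun : IsExecution ω κlo κhi φ x s T S y) :
    (T : ℝ) ≤ (40 * Real.exp 1 * (k : ℝ) ^ 2 * (n : ℝ)) ^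
      ((Module.finrank ℝ (Submodule.span ℝ (Set.range fun j => φ (x j))) + 1) * k - 1) ∧
    (HasReturned ω (fun j => φ (x j)) T S y ∨
      ∃ (S' : ℕ → Fin k → V) (y' : ℕ → Fin k → Fin n → ℝ),
        IsExecution ω κlo κhi φ x s (T + 1) S' y' ∧ ∀ l < T, S' l = S l ∧ y' l = y l) := by
  have hk₀ : 0 < k := by omega
  have : Nonempty (Fin k) := ⟨⟨0, hk₀⟩⟩
  have hpos : 0 < ∑ j, ω j := (Finset.sum_pos (fun i _ => hκlo i) Finset.univ_nonempty).trans_le hlo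
  have hn : 0 < n := Nat.pos_of_ne_zero fun h => by subst h; simp at hpos
  constructor
  · set N := (Module.finrank ℝ (Submodule.span ℝ (Set.range fun j => φ (x j))) + 1) * k - 1
    have hN : k ≤ N + 1 := (Nat.le_mul_of_pos_left k (Nat.succ_pos _)).trans le_tsub_add
    have hb : 1 ≤ k * (k * n) := Nat.mul_pos hk₀ (Nat.mul_pos hk₀ hn)
    calc (T : ℝ) ≤ ((81 * (k * (k * n)) : ℕ) : ℝ) ^ N := by
          exact_mod_cast le_pow_of_half_le hb (by omega) (hrun.half_le hk₀ hω hκlo)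
      _ ≤ _ := by gcongr; exact cast_eighty_one_mul_le k n
  · exact or_iff_not_imp_left.2 <| hrun.exists_succ <|
      partitionPolytope_nonempty (fun i => (hκlo i).le) hκ hpos hlo hhi

theorem corollary6p1 {V : Type*} [NormedAddCommGroup V] [InnerProductSpace ℝ V]
    [FiniteDimensional ℝ V] (k n d : ℕ) (hk : 2 ≤ k) (hn : k ≤ n)
    (x : Fin n → EuclideanSpace ℝ (Fin d)) (hx : Function.Injective x)
    (ω : Fin n → ℝ) (hω : ∀ j, 0 < ω j)
    (κlo κhi : Fin k → ℝ) (hκlo : ∀ i, 0 < κlo i) (hκ : ∀ i, κlo i ≤ κhi i)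
    (hlo : ∑ i, κlo i ≤ ∑ j, ω j) (hhi : ∑ j, ω j ≤ ∑ i, κhi i)
    (φ : EuclideanSpace ℝ (Fin d) → V) (s : Fin k → EuclideanSpace ℝ (Fin d))
    (T : ℕ) (S : ℕ → Fin k → V) (y : ℕ → Fin k → Fin n → ℝ)
    (hrun : WeightBalancedKernelKMeans.IsExecution ω κlo κhi φ x s T S y) :
    -- no execution performs more iterations than the bound
    (T : ℝ) ≤ (40 * Real.exp 1 * (k : ℝ) ^ 2 * (n : ℝ)) ^ ((Module.finrank ℝ V + 1) * k - 1) ∧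
    -- and an execution never gets stuck: it has returned, or the next iteration can be performed
    (WeightBalancedKernelKMeans.HasReturned ω (fun j => φ (x j)) T S y ∨
      ∃ (S' : ℕ → Fin k → V) (y' : ℕ → Fin k → Fin n → ℝ),
        WeightBalancedKernelKMeans.IsExecution ω κlo κhi φ x s (T + 1) S' y' ∧
        ∀ l < T, S' l = S l ∧ y' l = y l) := by
  exact (corollary6p1_general k n d hk x ω hω κlo κhi hκlo hκ hlo hhi φ s T S y hrun).imp_left
    fun h => h.trans (pow_le_pow_right₀ (WeightBalancedKernelKMeans.one_le_forty_mul_exp_one_mul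
      (by omega) (by omega)) (by gcongr; exact Submodule.finrank_le _))
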